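/- An instance of the periodic event scheduling problem consists of a digraph $G$ with finite vertex set $V$ and arc set $A \subseteq V \times V$, a period $T \in \mathbb{Z}_{>0}$, bounds $\ell, u \in \mathbb{R}^{A}$ and weights $w \in \mathbb{R}^{A}$ (the weights play no role below). Assume that $G$ is (weakly) connected, without loops and without antiparallel arcs, and that $0 \le \ell_a < T$ and $0 \le u_a - \ell_a < T$ for all $a \in A$. Let $B \in \{-1,0,1\}^{V \times A}$ be the incidence matrix of $G$, with $B_{i,a} = 1$ and $B_{j,a} = -1$ for $a = (i,j)$. An oriented cycle is a vector $\gamma \in \{-1,0,1\}^{A}$ with $B\gamma = 0$; the cycle space is the subgroup of $\mathbb{Z}^{A}$ generated by the oriented cycles, and $\mu$ is its rank. An integral cycle basis $\mathscr{B}$ is a $\mu$-tuple $(\gamma_1, \dots, \gamma_\mu)$ of oriented cycles that generates the cycle space as a $\mathbb{Z}$-module; its cycle matrix $\Gamma \in \mathbb{Z}^{\mu \times A}$ has the rows $\gamma_1, \dots, \gamma_\mu$. The cycle offset zonotope is $$Z = \{ z \in \mathbb{R}^{\mu} \mid \exists x \in \mathbb{R}^{A} : \Gamma x = Tz,\ \ell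 \le x \le u \}.$$ The space of feasible periodic timetables is $$\Pi = \{ \pi \in \mathbb{R}^{V} \mid \exists p \in \mathbb{Z}^{A}\ \forall (i,j) \in A : \ell_{ij} \le \pi_j - \pi_i + Tp_{ij} \le u_{ij} \},$$ and for $p \in \mathbb{Z}^{A}$ we put $$R(p) = \{ \pi \in \mathbb{R}^{V} \mid \forall (i,j) \in A : \ell_{ij} - Tp_{ij} \le \pi_j - \pi_i \le u_{ij} - Tp_{ij} \}.$$ Let $\mathscr{T} = (\mathbb{R}^{V} / (T\mathbb{Z})^{V}) / \mathbb{R}\mathbf{1}$, and let $\mathbf{R}(p) \subseteq \mathscr{T}$ be the image of $R(p)$. The non-empty polytropes in $\mathscr{T}$ are the non-empty sets among the $\mathbf{R}(p)$, $p \in \mathbb{Z}^{A}$. Theorem. Let $\mathscr{B}$ be an integral cycle basis of $G$. 1. For each $z \in \mathbb{Z}^{\mu}$ there is a $p \in \mathbb{Z}^{A}$ with $\Gamma p = z$, and the set $\mathfrak{R}(z) := \mathbf{R}(p)$ does not depend on the choice of such a $p$. 2. The map $z \mapsto \mathfrak{R}(z)$ is a bijection from the set $Z \cap \mathbb{Z}^{\mu}$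 of integer points of the cycle offset zonotope to the set of non-empty polytropes in $\mathscr{T}$. 3. The non-empty polytropes in $\mathscr{T}$ are pairwise disjoint, and their union is the image of $\Pi$ in $\mathscr{T}$. Their number is finite and at most the number of spanning trees of (the undirected graph underlying) $G$. -/

import Mathlib

noncomputable section

namespace PESP

/-- The arcs `(i, j)` of a digraph. -/
def Arc {V : Type*} (G : Digraph V) : Type _ := {e : V × V // G.Adj e.1 e.2}

namespace Arc

/-- The tail `i` of the arc `(i, j)`. -/
def tail {V : Type*} {G : Digraph V} (a : Arc G) : V := a.1.1

/-- The head `j` of the arc `(i, j)`. -/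
def head {V : Type*} {G : Digraph V} (a : Arc G) : V := a.1.2

instance instFinite {V : Type*} [Finite V] (G : Digraph V) : Finite (Arc G) :=
  inferInstanceAs (Finite {e : V × V // G.Adj e.1 e.2})

instance instFintype {V : Type*} [Finite V] (G : Digraph V) : Fintype (Arc G) :=
  Fintype.ofFinite _

end Arc

/-- The data `(G, T, l, u, w)` of a periodic event scheduling problem on the vertex set `V`. -/
structure Instance (V : Type*) where
  G : Digraph V
  T : ℕ
  l : Arc G → ℝ
  u : Arc G → ℝ
  w : Arc G → ℝ

/-- The undirected graph underlying a digraph. -/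
def underlyingGraph {V : Type*} (G : Digraph V) : SimpleGraph V := G.toSimpleGraphInclusive

/-- The standard assumptions on an instance: the period is positive, the digraph is (weakly)
connected, has no loops and no antiparallel arcs (parallel arcs are excluded by the type
`Digraph`), and `0 ≤ l < T`, `0 ≤ u - l < T`. -/
structure Instance.IsStandard {V : Type*} (I : Instance V) : Prop where
  period_pos : 0 < I.T
  loopless : ∀ v, ¬ I.G.Adj v v
  no_antiparallel : ∀ v v', I.G.Adj v v' → ¬ I.G.Adj v' v
  connected : (underlyingGraph I.G).Connected
  lower_nonneg : ∀ a, 0 ≤ I.l a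
  lower_lt : ∀ a, I.l a < I.T
  span_nonneg : ∀ a, 0 ≤ I.u a - I.l a
  span_lt : ∀ a, I.u a - I.l a < I.T

/-- The set of spanning trees of a digraph: the trees on the whole vertex set all of whose edges
come from arcs of the digraph. -/
def spanningTrees {V : Type*} (G : Digraph V) : Set (SimpleGraph V) :=
  {S | S ≤ underlyingGraph G ∧ S.IsTree}

open Classical in
/-- The incidence matrix, with `+1` at the tail and `-1` at the head of each arc, so that
`(-Bᵀ π) (i, j) = π j - π i`. -/
def incidenceMatrix {V : Type*} (G : Digraph V) : Matrix V (Arc G) ℤ :=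
  Matrix.of fun v a => (if v = a.tail then 1 else 0) - (if v = a.head then 1 else 0)

/-- Oriented cycles: vectors `γ` with entries in `{-1, 0, 1}` and `B γ = 0`. -/
def IsOrientedCycle {V : Type*} [Finite V] (G : Digraph V) (γ : Arc G → ℤ) : Prop :=
  (∀ a, γ a = -1 ∨ γ a = 0 ∨ γ a = 1) ∧ (incidenceMatrix G).mulVec γ = 0

/-- The cycle space: the subgroup of `ℤ^A` generated by the oriented cycles. -/
def cycleSpace {V : Type*} [Finite V] (G : Digraph V) : Submodule ℤ (Arc G → ℤ) :=
  Submodule.span ℤ {γ | IsOrientedCycle G γ}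

/-- The cyclomatic number `μ`: the rank of the cycle space. -/
def cyclomaticNumber {V : Type*} [Finite V] (G : Digraph V) : ℕ :=
  Module.finrank ℤ (cycleSpace G)

/-- An integral cycle basis: a `μ`-tuple of oriented cycles that generates the cycle space as a
`ℤ`-module. -/
structure IntegralCycleBasis {V : Type*} [Finite V] (G : Digraph V) where
  cycle : Fin (cyclomaticNumber G) → Arc G → ℤ
  isOrientedCycle : ∀ k, IsOrientedCycle G (cycle k)
  span_eq : Submodule.span ℤ (Set.range cycle) = cycleSpace G

/-- The cycle matrix `Γ`, whose rows are the cycles of the basis. -/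
def IntegralCycleBasis.matrix {V : Type*} [Finite V] {G : Digraph V} (B : IntegralCycleBasis G) :
    Matrix (Fin (cyclomaticNumber G)) (Arc G) ℤ :=
  Matrix.of B.cycle

namespace Instance

/-- The space `Π` of feasible periodic timetables. -/
def timetableSpace {V : Type*} (I : Instance V) : Set (V → ℝ) :=
  {π | ∃ p : Arc I.G → ℤ, ∀ a,
    I.l a ≤ π a.head - π a.tail + I.T * p a ∧ π a.head - π a.tail + I.T * p a ≤ I.u a}

/-- The polyhedron `R(p)`. -/
def polyhedron {V : Type*} (I : Instance V) (p : Arc I.G → ℤ) : Set (V → ℝ) :=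
  {π | ∀ a, I.l a - I.T * p a ≤ π a.head - π a.tail ∧
    π a.head - π a.tail ≤ I.u a - I.T * p a}

/-- The cycle offset zonotope `Z`. -/
def zonotope {V : Type*} [Finite V] (I : Instance V) (B : IntegralCycleBasis I.G) :
    Set (Fin (cyclomaticNumber I.G) → ℝ) :=
  {z | ∃ x : Arc I.G → ℝ,
    (B.matrix.map (fun k : ℤ => (k : ℝ))).mulVec x = (I.T : ℝ) • z ∧
      ∀ a, I.l a ≤ x a ∧ x a ≤ I.u a}

/-- The integer points of the cycle offset zonotope. -/
def integerPoints {V : Type*} [Finite V] (I : Instance V) (B : IntegralCycleBasis I.G) :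
    Set (Fin (cyclomaticNumber I.G) → ℤ) :=
  {z | (fun k => (z k : ℝ)) ∈ I.zonotope B}

end Instance

/-- The lattice `(Tℤ)^V`. -/
def periodLattice (V : Type*) (T : ℕ) : AddSubgroup (V → ℝ) :=
  AddSubgroup.pi Set.univ fun _ => AddSubgroup.zmultiples (T : ℝ)

/-- The line `ℝ𝟏` spanned by the all-ones vector. -/
def onesLine (V : Type*) : AddSubgroup (V → ℝ) :=
  (Submodule.span ℝ {(1 : V → ℝ)}).toAddSubgroup

/-- The torus `(ℝ^V / (Tℤ)^V) / ℝ𝟏`. -/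
def Torus (V : Type*) (T : ℕ) : Type _ :=
  ((V → ℝ) ⧸ periodLattice V T) ⧸ (onesLine V).map (QuotientAddGroup.mk' (periodLattice V T))

/-- The projection of `ℝ^V` onto the torus. -/
def toTorus (V : Type*) (T : ℕ) (π : V → ℝ) : Torus V T :=
  QuotientAddGroup.mk' ((onesLine V).map (QuotientAddGroup.mk' (periodLattice V T)))
    (QuotientAddGroup.mk' (periodLattice V T) π)

namespace Instance

/-- The image `𝐑(p)` of the polyhedron `R(p)` in the torus. -/
def torusPolytrope {V : Type*} (I : Instance V) (p : Arc I.G → ℤ) : Set (Torus V I.T) :=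
  toTorus V I.T '' I.polyhedron p

/-- The region of a cycle offset `z`: the common value `𝐑(p)` for all `p` with `Γ p = z`. It is
written as a union over all these `p`. -/
def offsetPolytrope {V : Type*} [Finite V] (I : Instance V) (B : IntegralCycleBasis I.G)
    (z : Fin (cyclomaticNumber I.G) → ℤ) : Set (Torus V I.T) :=
  ⋃ p ∈ {p : Arc I.G → ℤ | B.matrix.mulVec p = z}, I.torusPolytrope p

/-- The non-empty polytropes in the torus, i.e. the members of the decomposition of the timetable
space on the torus. -/
def polytropes {V : Type*} (I : Instance V) : Set (Set (Torus V I.T)) :=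
  {P | P.Nonempty ∧ ∃ p : Arc I.G → ℤ, P = I.torusPolytrope p}

end Instance

end PESP

end

/-!
Write `Γ` for the cycle matrix and call `φ(j) - φ(i)`, for an arc `(i, j)`, the coboundary of a
potential `φ`.

**Cycle space.** Fundamental cycles of a spanning tree show that the cycle space is the whole
kernel of the incidence matrix (`mem_cycleSpace_iff`). Hence a vector annihilated by `Γ` is a
coboundary, over `ℤ` and over `ℝ` alike (`exists_potential`). The cycle space is moreover a direct
summand of `ℤ^A`, so `Γ : ℤ^A → ℤ^μ` is surjective (`exists_matrix_mulVec_eq`).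

**Polytropes.** Two points of `ℝ^V` agree in the torus exactly if they differ by `T` times an
integer vector and a constant (`toTorus_eq_iff`), so adding an integral coboundary to `p` does not
change the image of `R(p)`. Conversely, if the images of `R(p)` and `R(p')` meet, the tensions `π j
- π i + T p (i, j)` of the two points agree modulo `T` and lie in common intervals of length less
than `T`, so they are equal and `p - p'` is a coboundary (`exists_eq_add_coboundary`). Thus
polytropes are disjoint or equal, and they correspond to the values `Γ p`. Such a value lies in the
zonotope if and only if `R(p)` is non-empty (`mulVec_mem_integerPoints_iff`), since `Γ x = T Γ p`
means that `x - T p` is a real coboundary.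

**Counting.** Fix a root. Pushing the potential down on the set of vertices not yet reached by tight
constraints leads from any point of `R(p)` to a point at which the constraints pointing away from
the root in some spanning tree are tight (`exists_tight_isTree`): tree arcs directed away from the
root attain their lower bound, the others their upper bound. The tree alone determines the tensions
on its arcs modulo `T`, hence the point of the torus (`toTorus_eq_of_tight`) and the polytrope. This
is an injection from the polytropes into the spanning trees.
-/

noncomputable section

namespace PESP

open scoped Classical

variable {V : Type*}

/-! ### Incidence matrix and walks -/

theorem incidenceMatrix_mulVec_apply [Finite V] (G : Digraph V) (γ : Arc G → ℤ) (v : V) :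
    (incidenceMatrix G).mulVec γ v =
      ∑ a, ((if v = a.tail then 1 else 0) - (if v = a.head then 1 else 0)) * γ a := rfl

/-- Adjointness of the incidence matrix and the coboundary operator. -/
theorem sum_mul_coboundary [Fintype V] {R : Type*} [CommRing R] (G : Digraph V)
    (γ : Arc G → ℤ) (φ : V → R) :
    ∑ a, (γ a : R) * (φ a.tail - φ a.head) =
      ∑ v, φ v * (((incidenceMatrix G).mulVec γ v : ℤ) : R) := by
  simp only [incidenceMatrix_mulVec_apply, Int.cast_sum, Finset.mul_sum]
  rw [Finset.sum_comm]
  refine Finset.sum_congr rfl fun a _ => ?_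
  simp [mul_sub, Finset.sum_sub_distrib, mul_comm]

theorem sum_mul_coboundary_eq_zero [Finite V] {R : Type*} [CommRing R] {G : Digraph V}
    {γ : Arc G → ℤ} (hγ : (incidenceMatrix G).mulVec γ = 0) (φ : V → R) :
    ∑ a, (γ a : R) * (φ a.head - φ a.tail) = 0 := by
  cases nonempty_fintype V
  have h := sum_mul_coboundary G γ φ
  simp only [hγ, Pi.zero_apply, Int.cast_zero, mul_zero, Finset.sum_const_zero] at h
  rw [← neg_eq_zero, ← Finset.sum_neg_distrib, ← h]
  exact Finset.sum_congr rfl fun a _ => by ring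

theorem incidenceMatrix_mulVec_single [Finite V] (G : Digraph V) (a : Arc G) :
    (incidenceMatrix G).mulVec (Pi.single a 1) = Pi.single a.tail 1 - Pi.single a.head 1 := by
  ext v
  simp [incidenceMatrix_mulVec_apply, Pi.single_apply]

/-- The arc `(u, v)`. -/
def arcOfAdj {G : Digraph V} {u v : V} (h : G.Adj u v) : Arc G := ⟨(u, v), h⟩

/-- The signed arc vector of a step from `u` to `v`: an arc `(u, v)` counts `1`, an arc `(v, u)`
counts `-1`. -/
def stepVector (G : Digraph V) (u v : V) : Arc G → ℤ := fun a =>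
  (if a.1 = (u, v) then 1 else 0) - (if a.1 = (v, u) then 1 else 0)

/-- The signed arc vector of a walk. -/
def walkVector (G : Digraph V) {H : SimpleGraph V} : {u v : V} → H.Walk u v → Arc G → ℤ
  | _, _, .nil => 0
  | u, _, .cons (v := v) _ p => stepVector G u v + walkVector G p

theorem stepVector_eq_single {G : Digraph V} (hG : ∀ v w, G.Adj v w → ¬ G.Adj w v) {u v : V}
    (h : G.Adj u v) : stepVector G u v = Pi.single (arcOfAdj h) 1 := by
  ext a
  have h2 : a.1 ≠ (v, u) := fun e => hG _ _ h (by have := a.2; rwa [e] at this)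
  have h3 : a = arcOfAdj h ↔ a.1 = (u, v) := Subtype.ext_iff
  simp [stepVector, Pi.single_apply, h2, h3]

theorem stepVector_swap (G : Digraph V) (u v : V) : stepVector G v u = -stepVector G u v := by
  ext a
  simp [stepVector]

theorem incidenceMatrix_mulVec_stepVector [Finite V] {G : Digraph V}
    (hG : ∀ v w, G.Adj v w → ¬ G.Adj w v) {u v : V} (h : (underlyingGraph G).Adj u v) :
    (incidenceMatrix G).mulVec (stepVector G u v) = Pi.single u 1 - Pi.single v 1 := by
  rcases h.2 with h | h
  · rw [stepVector_eq_single hG h, incidenceMatrix_mulVec_single]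
    rfl
  · rw [stepVector_swap, Matrix.mulVec_neg, stepVector_eq_single hG h,
      incidenceMatrix_mulVec_single, neg_sub]
    rfl

theorem incidenceMatrix_mulVec_walkVector [Finite V] {G : Digraph V}
    (hG : ∀ v w, G.Adj v w → ¬ G.Adj w v) {H : SimpleGraph V} (hH : H ≤ underlyingGraph G)
    {u v : V} (p : H.Walk u v) :
    (incidenceMatrix G).mulVec (walkVector G p) = Pi.single u 1 - Pi.single v 1 := by
  induction p with
  | nil => simp [walkVector]
  | cons h p ih =>
    rw [walkVector, Matrix.mulVec_add, ih, incidenceMatrix_mulVec_stepVector hG (hH h)]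
    abel

theorem stepVector_eq_zero {G : Digraph V} {u v : V} {a : Arc G}
    (h : s(a.tail, a.head) ≠ s(u, v)) : stepVector G u v a = 0 := by
  obtain ⟨⟨i, j⟩, hij⟩ := a
  simp only [Arc.tail, Arc.head, ne_eq, Sym2.eq_iff, not_or] at h
  simp [stepVector, h]

theorem walkVector_eq_zero {G : Digraph V} {H : SimpleGraph V} {u v : V} (p : H.Walk u v)
    {a : Arc G} (h : s(a.tail, a.head) ∉ p.edges) : walkVector G p a = 0 := by
  induction p with
  | nil => rfl
  | cons _ p ih =>
    simp only [SimpleGraph.Walk.edges_cons, List.mem_cons, not_or] at h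
    simp [walkVector, ih h.2, stepVector_eq_zero h.1]

theorem walkVector_of_isTrail {G : Digraph V} {H : SimpleGraph V} {u v : V} (p : H.Walk u v)
    (hp : p.IsTrail) (a : Arc G) :
    walkVector G p a = -1 ∨ walkVector G p a = 0 ∨ walkVector G p a = 1 := by
  induction p with
  | nil => exact Or.inr (Or.inl rfl)
  | @cons u v w h p ih =>
    rw [SimpleGraph.Walk.isTrail_cons] at hp
    simp only [walkVector, Pi.add_apply]
    by_cases ha : s(a.tail, a.head) = s(u, v)
    · rw [walkVector_eq_zero p (ha ▸ hp.2)]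
      unfold stepVector
      split_ifs <;> simp
    · rw [stepVector_eq_zero ha, zero_add]
      exact ih hp.1

/-! ### The cycle space is the kernel of the incidence matrix -/

/-- Testing a circulation against the indicator function of one side of the cut that is left when
a tree arc is removed shows that the circulation vanishes on that arc. -/
theorem eq_zero_of_support_subset_isAcyclic [Finite V] {G : Digraph V}
    (hG : ∀ v w, G.Adj v w → ¬ G.Adj w v) {S : SimpleGraph V} (hS : S.IsAcyclic)
    {γ : Arc G → ℤ} (hγ : (incidenceMatrix G).mulVec γ = 0)
    (h0 : ∀ a : Arc G, ¬ S.Adj a.tail a.head → γ a = 0) : γ = 0 := by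
  funext a
  by_cases ha : S.Adj a.tail a.head
  · set φ : V → ℤ := fun v =>
      if (S.deleteEdges {s(a.tail, a.head)}).Reachable a.tail v then 1 else 0 with hφ
    have hbridge := SimpleGraph.isAcyclic_iff_forall_adj_isBridge.1 hS ha
    rw [SimpleGraph.isBridge_iff] at hbridge
    have hsum := sum_mul_coboundary_eq_zero hγ φ
    rw [Finset.sum_eq_single a] at hsum
    · simpa [hφ, hbridge] using hsum
    · intro b _ hba
      by_cases hb : S.Adj b.tail b.head
      · have hne : s(b.tail, b.head) ≠ s(a.tail, a.head) := by
          intro he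
          rcases Sym2.eq_iff.1 he with ⟨h1, h2⟩ | ⟨h1, h2⟩
          · exact hba (Subtype.ext (Prod.ext h1 h2))
          · refine hG _ _ a.2 ?_
            have := b.2
            change G.Adj b.tail b.head at this
            rwa [h1, h2] at this
        have hadj : (S.deleteEdges {s(a.tail, a.head)}).Adj b.tail b.head := by
          rw [SimpleGraph.deleteEdges_adj]
          exact ⟨hb, hne⟩
        have : φ b.head = φ b.tail := by
          simp only [hφ]
          congr 1
          exact propext ⟨fun h => h.trans hadj.symm.reachable, fun h => h.trans hadj.reachable⟩
        simp [this]
      · simp [h0 b hb]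
    · simp
  · exact h0 a ha

/-- The fundamental cycle of an arc outside a spanning tree. -/
theorem exists_isOrientedCycle_of_not_adj [Finite V] {G : Digraph V}
    (hG : ∀ v w, G.Adj v w → ¬ G.Adj w v) {S : SimpleGraph V} (hS : S.Connected)
    (hle : S ≤ underlyingGraph G) (a : Arc G) (ha : ¬ S.Adj a.tail a.head) :
    ∃ γ, IsOrientedCycle G γ ∧ ∀ b : Arc G, ¬ S.Adj b.tail b.head →
      γ b = if b = a then 1 else 0 := by
  obtain ⟨p, hp⟩ := (hS a.head a.tail).exists_isPath
  have hz : ∀ b : Arc G, ¬ S.Adj b.tail b.head → walkVector G p b = 0 := fun b hb =>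
    walkVector_eq_zero p fun he => hb (p.adj_of_mem_edges he)
  refine ⟨walkVector G p + Pi.single a 1, ⟨fun b => ?_, ?_⟩, fun b hb => ?_⟩
  · by_cases hb : b = a
    · subst hb
      simp [hz b ha]
    · simpa [Pi.single_apply, hb] using walkVector_of_isTrail p hp.isTrail b
  · rw [Matrix.mulVec_add, incidenceMatrix_mulVec_walkVector hG hle,
      incidenceMatrix_mulVec_single]
    abel
  · simp [hz b hb, Pi.single_apply]

theorem mem_cycleSpace_iff [Finite V] {G : Digraph V} (hG : ∀ v w, G.Adj v w → ¬ G.Adj w v)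
    (hconn : (underlyingGraph G).Connected) {γ : Arc G → ℤ} :
    γ ∈ cycleSpace G ↔ (incidenceMatrix G).mulVec γ = 0 := by
  constructor
  · intro h
    have : cycleSpace G ≤ LinearMap.ker (incidenceMatrix G).mulVecLin :=
      Submodule.span_le.2 fun γ hγ => hγ.2
    exact this h
  · intro h
    obtain ⟨S, hle, hS⟩ := hconn.exists_isTree_le
    choose! c hc1 hc2 using exists_isOrientedCycle_of_not_adj hG hS.connected hle
    set N : Finset (Arc G) := Finset.univ.filter fun a => ¬ S.Adj a.tail a.head with hN
    have hmem : ∀ a ∈ N, ¬ S.Adj a.tail a.head := fun a ha => (Finset.mem_filter.1 ha).2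
    have key : γ - ∑ a ∈ N, γ a • c a = 0 := by
      refine eq_zero_of_support_subset_isAcyclic hG hS.isAcyclic ?_ fun b hb => ?_
      · rw [Matrix.mulVec_sub, h, Matrix.mulVec_sum, Finset.sum_eq_zero, sub_zero]
        intro a ha
        rw [Matrix.mulVec_smul, (hc1 a (hmem a ha)).2, smul_zero]
      · rw [Pi.sub_apply, Finset.sum_apply, Finset.sum_congr rfl fun a ha => by
          rw [Pi.smul_apply, hc2 a (hmem a ha) b hb]]
        have hbN : b ∈ N := by simp [hN, hb]
        simp [hbN]
    rw [sub_eq_zero.1 key]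
    exact Submodule.sum_mem _ fun a ha =>
      Submodule.smul_mem _ _ (Submodule.subset_span (hc1 a (hmem a ha)))

/-! ### The cycle matrix -/

/-- A vector that is orthogonal to every cycle of the basis is a coboundary. -/
theorem exists_potential [Finite V] {G : Digraph V} (hG : ∀ v w, G.Adj v w → ¬ G.Adj w v)
    (hconn : (underlyingGraph G).Connected) (B : IntegralCycleBasis G) {R : Type*} [CommRing R]
    (x : Arc G → R) (hx : ∀ k, ∑ a, (B.cycle k a : R) * x a = 0) :
    ∃ φ : V → R, ∀ a : Arc G, x a = φ a.head - φ a.tail := by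
  obtain ⟨r⟩ := hconn.nonempty
  let f : (Arc G → ℤ) →ₗ[ℤ] R :=
    { toFun := fun γ => ∑ a, (γ a : R) * x a
      map_add' := fun γ γ' => by simp [add_mul, Finset.sum_add_distrib]
      map_smul' := fun m γ => by simp [mul_assoc, Finset.mul_sum] }
  have hf : ∀ γ, (incidenceMatrix G).mulVec γ = 0 → f γ = 0 := by
    intro γ hγ
    rw [← mem_cycleSpace_iff hG hconn, ← B.span_eq] at hγ
    have : Submodule.span ℤ (Set.range B.cycle) ≤ LinearMap.ker f := by
      rw [Submodule.span_le]
      rintro _ ⟨k, rfl⟩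
      exact hx k
    exact this hγ
  have p : ∀ v, (underlyingGraph G).Walk r v := fun v => (hconn r v).some
  refine ⟨fun v => f (walkVector G (p v)), fun a => ?_⟩
  have h := hf (walkVector G (p a.tail) + Pi.single a 1 - walkVector G (p a.head)) (by
    rw [Matrix.mulVec_sub, Matrix.mulVec_add, incidenceMatrix_mulVec_walkVector hG le_rfl,
      incidenceMatrix_mulVec_walkVector hG le_rfl, incidenceMatrix_mulVec_single]
    abel)
  have hs : f (Pi.single a 1) = x a := by
    simp [f, Pi.single_apply]
  rw [map_sub, map_add, hs] at h
  linear_combination h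

/-- The cycle space is a direct summand of `ℤ^A`, because the range of the incidence matrix is
free. -/
theorem exists_retraction [Finite V] {G : Digraph V} (hG : ∀ v w, G.Adj v w → ¬ G.Adj w v)
    (hconn : (underlyingGraph G).Connected) :
    ∃ q : (Arc G → ℤ) →ₗ[ℤ] cycleSpace G, ∀ γ : cycleSpace G, q γ = γ := by
  cases nonempty_fintype V
  set b := (incidenceMatrix G).mulVecLin with hb
  obtain ⟨s, hs⟩ := b.rangeRestrict.exists_rightInverse_of_surjective b.range_rangeRestrict
  have hs' : ∀ y, b (s y) = y := fun y => congrArg Subtype.val (LinearMap.congr_fun hs y)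
  refine ⟨LinearMap.codRestrict _ (LinearMap.id - s ∘ₗ b.rangeRestrict) fun γ => ?_, fun γ => ?_⟩
  · rw [mem_cycleSpace_iff hG hconn]
    change b _ = 0
    simp [hs']
  · have : b.rangeRestrict γ = 0 := Subtype.ext ((mem_cycleSpace_iff hG hconn).1 γ.2)
    ext1
    simp [this]

/-- A generating `μ`-tuple of a free module of rank `μ` is a basis, so every integer vector is the
value of a functional on the cycle space; the retraction extends this functional to `ℤ^A`. -/
theorem exists_matrix_mulVec_eq [Finite V] {G : Digraph V}
    (hG : ∀ v w, G.Adj v w → ¬ G.Adj w v) (hconn : (underlyingGraph G).Connected)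
    (B : IntegralCycleBasis G) (z : Fin (cyclomaticNumber G) → ℤ) :
    ∃ p, B.matrix.mulVec p = z := by
  obtain ⟨q, hq⟩ := exists_retraction hG hconn
  have hmem : ∀ k, B.cycle k ∈ cycleSpace G := fun k =>
    B.span_eq ▸ Submodule.subset_span ⟨k, rfl⟩
  let c : Fin (cyclomaticNumber G) → cycleSpace G := fun k => ⟨B.cycle k, hmem k⟩
  have hspan : ⊤ ≤ Submodule.span ℤ (Set.range c) :=
    ((Submodule.span_range_subtype_eq_top_iff _ hmem).2 B.span_eq).ge
  have hli : LinearIndependent ℤ c :=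
    linearIndependent_of_top_le_span_of_card_eq_finrank hspan (Fintype.card_fin _)
  let f := (Module.Basis.mk hli hspan).constr ℤ z
  have hf : ∀ k, f (c k) = z k := fun k => by
    have := (Module.Basis.mk hli hspan).constr_basis ℤ z k
    rwa [Module.Basis.mk_apply] at this
  refine ⟨fun a => f (q (Pi.single a 1)), funext fun k => ?_⟩
  have h : B.cycle k = ∑ a, B.cycle k a • (Pi.single a 1 : Arc G → ℤ) := by
    ext b
    simp [Finset.sum_apply, Pi.single_apply]
  have h2 := hf k
  rw [← hq (c k)] at h2
  change f (q (B.cycle k)) = _ at h2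
  rw [h] at h2
  simp only [map_sum, map_smul, smul_eq_mul] at h2
  exact h2

/-! ### Polytropes in the torus -/

theorem toTorus_eq_iff {T : ℕ} {π π' : V → ℝ} :
    toTorus V T π = toTorus V T π' ↔
      ∃ (k : V → ℤ) (c : ℝ), ∀ v, π' v = π v + T * k v + c := by
  unfold toTorus
  refine QuotientAddGroup.eq.trans ?_
  simp only [AddSubgroup.mem_map]
  constructor
  · rintro ⟨y, hy, h⟩
    obtain ⟨c, rfl⟩ := Submodule.mem_span_singleton.1 hy
    have h2 := QuotientAddGroup.eq.1 (h : ((c • (1 : V → ℝ) : V → ℝ) :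
      (V → ℝ) ⧸ periodLattice V T) = ((-π + π' : V → ℝ)))
    have h3 : ∀ v, ∃ k : ℤ, k • (T : ℝ) = (-(c • (1 : V → ℝ)) + (-π + π')) v := fun v =>
      AddSubgroup.mem_zmultiples_iff.1 (h2 v (Set.mem_univ v))
    choose k hk using h3
    refine ⟨k, c, fun v => ?_⟩
    have := hk v
    simp at this
    linarith
  · rintro ⟨k, c, h⟩
    refine ⟨c • (1 : V → ℝ), Submodule.mem_span_singleton.2 ⟨c, rfl⟩, ?_⟩
    refine QuotientAddGroup.eq.2 fun v _ => AddSubgroup.mem_zmultiples_iff.2 ⟨k v, ?_⟩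
    simp [h v]
    ring

namespace IntegralCycleBasis

variable [Finite V] {G : Digraph V}

theorem sum_mul_coboundary_eq_zero (B : IntegralCycleBasis G) {R : Type*} [CommRing R]
    (k : Fin (cyclomaticNumber G)) (φ : V → R) :
    ∑ a, (B.cycle k a : R) * (φ a.head - φ a.tail) = 0 :=
  PESP.sum_mul_coboundary_eq_zero (B.isOrientedCycle k).2 φ

theorem matrix_mulVec_add_coboundary (B : IntegralCycleBasis G) (p : Arc G → ℤ) (φ : V → ℤ) :
    B.matrix.mulVec (fun a => p a + (φ a.head - φ a.tail)) = B.matrix.mulVec p := by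
  funext k
  have h := B.sum_mul_coboundary_eq_zero k φ
  simp only [Int.cast_id] at h
  change ∑ a, B.cycle k a * _ = ∑ a, B.cycle k a * _
  simp only [mul_add, Finset.sum_add_distrib, h, add_zero]

end IntegralCycleBasis

namespace Instance

variable {I : Instance V}

/-- If `R(p)` and `R(p')` meet in the torus, then `p` and `p'` differ by a coboundary: the two
periodic tensions agree modulo `T` and lie in the same intervals of length less than `T`. -/
theorem exists_eq_add_coboundary (hI : I.IsStandard) {p p' : Arc I.G → ℤ} {π π' : V → ℝ}
    (hπ : π ∈ I.polyhedron p) (hπ' : π' ∈ I.polyhedron p')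
    (h : toTorus V I.T π = toTorus V I.T π') :
    ∃ k : V → ℤ, ∀ a : Arc I.G, p a = p' a + (k a.head - k a.tail) := by
  obtain ⟨k, c, hk⟩ := toTorus_eq_iff.1 h
  have hT : (0 : ℝ) < I.T := by exact_mod_cast hI.period_pos
  refine ⟨k, fun a => ?_⟩
  obtain ⟨h1, h2⟩ := hπ a
  obtain ⟨h3, h4⟩ := hπ' a
  rw [hk, hk] at h3 h4
  have h5 := hI.span_lt a
  have h6 : (I.T : ℝ) * ((p' a + (k a.head - k a.tail) - p a : ℤ) : ℝ) < I.T * (1 : ℤ) := by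
    push_cast
    linarith
  have h7 : (I.T : ℝ) * ((-1 : ℤ) : ℝ) < I.T * ((p' a + (k a.head - k a.tail) - p a : ℤ) : ℝ) := by
    push_cast
    linarith
  have h8 := Int.cast_lt.1 (lt_of_mul_lt_mul_left h6 hT.le)
  have h9 := Int.cast_lt.1 (lt_of_mul_lt_mul_left h7 hT.le)
  omega

theorem torusPolytrope_subset {p p' : Arc I.G → ℤ} {k : V → ℤ}
    (h : ∀ a : Arc I.G, p a = p' a + (k a.head - k a.tail)) :
    I.torusPolytrope p ⊆ I.torusPolytrope p' := by
  rintro _ ⟨π, hπ, rfl⟩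
  refine ⟨fun v => π v + I.T * k v, fun a => ?_, Eq.symm (toTorus_eq_iff.2 ⟨k, 0, by simp⟩)⟩
  obtain ⟨h1, h2⟩ := hπ a
  rw [h a] at h1 h2
  push_cast at h1 h2
  constructor <;> linarith

theorem torusPolytrope_eq {p p' : Arc I.G → ℤ} {k : V → ℤ}
    (h : ∀ a : Arc I.G, p a = p' a + (k a.head - k a.tail)) :
    I.torusPolytrope p = I.torusPolytrope p' :=
  (torusPolytrope_subset h).antisymm
    (torusPolytrope_subset (k := -k) fun a => by simp only [Pi.neg_apply]; linarith [h a])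

theorem torusPolytrope_eq_of_mulVec_eq [Finite V] (hI : I.IsStandard)
    (B : IntegralCycleBasis I.G) {p p' : Arc I.G → ℤ}
    (h : B.matrix.mulVec p = B.matrix.mulVec p') : I.torusPolytrope p = I.torusPolytrope p' := by
  obtain ⟨k, hk⟩ := exists_potential hI.no_antiparallel hI.connected B (p - p') fun k => by
    have := congrFun (Matrix.mulVec_sub B.matrix p p') k
    rw [h, sub_self] at this
    exact this
  refine torusPolytrope_eq (k := k) fun a => ?_
  have := hk a
  simp only [Pi.sub_apply] at this
  linarith

theorem offsetPolytrope_eq [Finite V] (hI : I.IsStandard) (B : IntegralCycleBasis I.G)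
    {p : Arc I.G → ℤ} {z : Fin (cyclomaticNumber I.G) → ℤ} (h : B.matrix.mulVec p = z) :
    I.offsetPolytrope B z = I.torusPolytrope p := by
  refine Set.Subset.antisymm (Set.iUnion₂_subset fun p' hp' => ?_)
    (Set.subset_biUnion_of_mem (u := fun p => I.torusPolytrope p) h)
  exact (torusPolytrope_eq_of_mulVec_eq hI B (Eq.trans hp' h.symm)).subset

theorem mem_polyhedron_iff {p : Arc I.G → ℤ} {π : V → ℝ} :
    π ∈ I.polyhedron p ↔ ∀ a, I.l a ≤ π a.head - π a.tail + I.T * p a ∧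
      π a.head - π a.tail + I.T * p a ≤ I.u a := by
  refine forall_congr' fun a => and_congr ?_ ?_ <;> constructor <;> intro h <;> linarith

/-- The integer vector `Γ p` is a point of the zonotope if and only if `R(p)` is non-empty: a
vector `x` with `Γ x = T Γ p` differs from `T p` by a coboundary. -/
theorem mulVec_mem_integerPoints_iff [Finite V] (hI : I.IsStandard) (B : IntegralCycleBasis I.G)
    (p : Arc I.G → ℤ) :
    B.matrix.mulVec p ∈ I.integerPoints B ↔ (I.polyhedron p).Nonempty := by
  have hcast : ∀ k, ((B.matrix.mulVec p k : ℤ) : ℝ) = ∑ a, (B.cycle k a : ℝ) * p a := by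
    intro k
    change ((∑ a, B.cycle k a * p a : ℤ) : ℝ) = _
    push_cast
    rfl
  constructor
  · rintro ⟨x, hx, hb⟩
    obtain ⟨π, hπ⟩ := exists_potential hI.no_antiparallel hI.connected B
        (fun a => x a - I.T * p a) fun k => by
      have h : ∑ a, (B.cycle k a : ℝ) * x a = I.T * ((B.matrix.mulVec p k : ℤ) : ℝ) :=
        congrFun hx k
      simp only [mul_sub, Finset.sum_sub_distrib]
      rw [h, hcast, Finset.mul_sum, sub_eq_zero]
      exact Finset.sum_congr rfl fun a _ => by ring
    refine ⟨π, mem_polyhedron_iff.2 fun a => ?_⟩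
    rw [← hπ a, sub_add_cancel]
    exact hb a
  · rintro ⟨π, hπ⟩
    refine ⟨fun a => π a.head - π a.tail + I.T * p a, ?_, mem_polyhedron_iff.1 hπ⟩
    funext k
    change ∑ a, (B.cycle k a : ℝ) * _ = I.T * ((B.matrix.mulVec p k : ℤ) : ℝ)
    simp only [mul_add, Finset.sum_add_distrib, B.sum_mul_coboundary_eq_zero k π]
    rw [hcast, Finset.mul_sum, zero_add]
    exact Finset.sum_congr rfl fun a _ => by ring

theorem torusPolytrope_eq_of_toTorus_eq (hI : I.IsStandard) {p p' : Arc I.G → ℤ} {π π' : V → ℝ}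
    (hπ : π ∈ I.polyhedron p) (hπ' : π' ∈ I.polyhedron p')
    (h : toTorus V I.T π = toTorus V I.T π') : I.torusPolytrope p = I.torusPolytrope p' := by
  obtain ⟨k, hk⟩ := exists_eq_add_coboundary hI hπ hπ' h
  exact torusPolytrope_eq hk

theorem bijOn_offsetPolytrope [Finite V] (hI : I.IsStandard) (B : IntegralCycleBasis I.G) :
    Set.BijOn (I.offsetPolytrope B) (I.integerPoints B) I.polytropes := by
  have hsurj := exists_matrix_mulVec_eq hI.no_antiparallel hI.connected B
  refine ⟨fun z hz => ?_, fun z hz z' hz' h => ?_, ?_⟩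
  · obtain ⟨p, rfl⟩ := hsurj z
    rw [offsetPolytrope_eq hI B rfl]
    exact ⟨((mulVec_mem_integerPoints_iff hI B p).1 hz).image _, p, rfl⟩
  · obtain ⟨p, rfl⟩ := hsurj z
    obtain ⟨p', rfl⟩ := hsurj z'
    rw [offsetPolytrope_eq hI B rfl, offsetPolytrope_eq hI B rfl] at h
    obtain ⟨π, hπ⟩ := (mulVec_mem_integerPoints_iff hI B p).1 hz
    obtain ⟨π', hπ', he⟩ := h.subset (Set.mem_image_of_mem _ hπ)
    obtain ⟨k, hk⟩ := exists_eq_add_coboundary hI hπ hπ' he.symm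
    rw [funext hk]
    exact B.matrix_mulVec_add_coboundary p' k
  · rintro _ ⟨hne, p, rfl⟩
    exact ⟨_, (mulVec_mem_integerPoints_iff hI B p).2 hne.of_image, offsetPolytrope_eq hI B rfl⟩

theorem sUnion_polytropes (I : Instance V) :
    ⋃₀ I.polytropes = toTorus V I.T '' I.timetableSpace := by
  ext t
  constructor
  · rintro ⟨_, ⟨-, p, rfl⟩, π, hπ, rfl⟩
    exact ⟨π, ⟨p, mem_polyhedron_iff.1 hπ⟩, rfl⟩
  · rintro ⟨π, ⟨p, hπ⟩, rfl⟩
    have hmem : toTorus V I.T π ∈ I.torusPolytrope p := ⟨π, mem_polyhedron_iff.2 hπ, rfl⟩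
    exact ⟨_, ⟨⟨_, hmem⟩, p, rfl⟩, hmem⟩

theorem pairwiseDisjoint_polytropes (hI : I.IsStandard) : I.polytropes.PairwiseDisjoint id := by
  rintro _ ⟨-, p, rfl⟩ _ ⟨-, p', rfl⟩ hne
  refine Set.disjoint_left.2 ?_
  rintro _ ⟨π, hπ, rfl⟩ ⟨π', hπ', h⟩
  exact hne (torusPolytrope_eq_of_toTorus_eq hI hπ hπ' h.symm)

end Instance

/-! ### Trees of tight constraints -/

/-- A feasible system of difference constraints `π v + c v w ≤ π w` along the edges of a connected
graph has a solution for which the constraints pointing away from the root in some arborescence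
are tight. The arborescence is given by a parent function and a depth function. -/
theorem exists_tight_parent [Finite V] {H : SimpleGraph V} (hH : H.Connected) (r : V)
    (c : V → V → ℝ) (hfeas : ∃ π : V → ℝ, ∀ v w, H.Adj v w → π v + c v w ≤ π w) :
    ∃ (π : V → ℝ) (par : V → V) (d : V → ℕ), (∀ v w, H.Adj v w → π v + c v w ≤ π w) ∧ d r = 0 ∧
      ∀ v, v ≠ r → H.Adj (par v) v ∧ π v = π (par v) + c (par v) v ∧ d v = d (par v) + 1 := by
  cases nonempty_fintype V
  have grow : ∀ n, 1 ≤ n → n ≤ Fintype.card V → ∃ (U : Finset V) (π : V → ℝ) (par : V → V)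
      (d : V → ℕ), U.card = n ∧ r ∈ U ∧ (∀ v w, H.Adj v w → π v + c v w ≤ π w) ∧ d r = 0 ∧
      ∀ v ∈ U, v ≠ r → par v ∈ U ∧
        H.Adj (par v) v ∧ π v = π (par v) + c (par v) v ∧ d v = d (par v) + 1 := by
    intro n hn
    induction n, hn using Nat.le_induction with
    | base =>
      obtain ⟨π, hπ⟩ := hfeas
      exact fun _ => ⟨{r}, π, id, 0, by simp, by simp, hπ, rfl, fun v hv hne =>
        absurd (Finset.mem_singleton.1 hv) hne⟩
    | succ n hn ih =>
      intro hcard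
      obtain ⟨U, π, par, d, hU, hr, hπ, hd, hpar⟩ := ih (by omega)
      have hout : ∃ w, w ∉ U := by
        by_contra! hall
        rw [Finset.eq_univ_iff_forall.2 hall, Finset.card_univ] at hU
        omega
      obtain ⟨w₁, hw₁⟩ := hout
      set E : Finset (V × V) :=
        Finset.univ.filter fun e => e.1 ∈ U ∧ e.2 ∉ U ∧ H.Adj e.1 e.2 with hE
      have hne : E.Nonempty := by
        obtain ⟨e, -, he1, he2⟩ := (hH r w₁).some.exists_boundary_dart (U : Set V) hr hw₁
        exact ⟨(e.fst, e.snd), by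
          simp only [hE, Finset.mem_filter, Finset.mem_univ, true_and]
          exact ⟨he1, he2, e.adj⟩⟩
      obtain ⟨⟨v₀, w₀⟩, he₀, hmin⟩ :=
        E.exists_min_image (fun e => π e.2 - π e.1 - c e.1 e.2) hne
      simp only [hE, Finset.mem_filter, Finset.mem_univ, true_and] at he₀
      obtain ⟨hv₀, hw₀, hadj⟩ := he₀
      have hε := hπ _ _ hadj
      -- the least slack of a constraint that leaves `U`; lowering all values outside `U` by it
      -- keeps every constraint and makes the constraint from `v₀` to `w₀` tight
      set ε : ℝ := π w₀ - π v₀ - c v₀ w₀ with hεdef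
      have hw₀r : w₀ ≠ r := fun h => hw₀ (h ▸ hr)
      refine ⟨insert w₀ U, fun v => if v ∈ U then π v else π v - ε, Function.update par w₀ v₀,
        Function.update d w₀ (d v₀ + 1), by rw [Finset.card_insert_of_notMem hw₀, hU],
        Finset.mem_insert_of_mem hr, fun v w hvw => ?_, ?_, fun v hv hvr => ?_⟩
      · have h := hπ v w hvw
        by_cases hv : v ∈ U <;> by_cases hw : w ∈ U <;> simp only [hv, hw, if_true, if_false]
        · exact h
        · have := hmin (v, w) (by simp [hE, hv, hw, hvw])
          simp only at this
          linarith
        · linarith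
        · linarith
      · rw [Function.update_of_ne hw₀r.symm, hd]
      · by_cases hvw : v = w₀
        · subst hvw
          have : v₀ ≠ v := fun h => hw₀ (h ▸ hv₀)
          simp only [Function.update_self, Function.update_of_ne this, hv₀, hw₀, if_true,
            if_false]
          exact ⟨Finset.mem_insert_of_mem hv₀, hadj, by linarith, trivial⟩
        · have hvU : v ∈ U := (Finset.mem_insert.1 hv).resolve_left hvw
          obtain ⟨h1, h2, h3, h4⟩ := hpar v hvU hvr
          have : par v ≠ w₀ := fun h => hw₀ (h ▸ h1)
          simp only [Function.update_of_ne hvw, Function.update_of_ne this, hvU, h1, if_true]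
          exact ⟨Finset.mem_insert_of_mem h1, h2, h3, h4⟩
  have := hH.nonempty
  obtain ⟨U, π, par, d, hU, -, hπ, hd, hpar⟩ := grow _ Fintype.card_pos le_rfl
  rw [Finset.card_eq_iff_eq_univ] at hU
  subst hU
  exact ⟨π, par, d, hπ, hd, fun v hv => (hpar v (Finset.mem_univ v) hv).2⟩

/-- The edges from the vertices to their parents form a spanning tree, in which the depth function
is the distance from the root. -/
theorem exists_isTree_of_parent [Finite V] {H : SimpleGraph V} (r : V) (par : V → V) (d : V → ℕ)
    (hd : d r = 0) (hpar : ∀ v, v ≠ r → H.Adj (par v) v ∧ d v = d (par v) + 1) :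
    ∃ S ≤ H, S.IsTree ∧ ∀ v w, S.Adj v w → S.dist r w = S.dist r v + 1 → w ≠ r ∧ v = par w := by
  cases nonempty_fintype V
  set S : SimpleGraph V := SimpleGraph.fromRel fun v w => w ≠ r ∧ v = par w with hS
  have hadj : ∀ v, v ≠ r → S.Adj (par v) v := fun v hv =>
    ⟨(hpar v hv).1.ne, Or.inl ⟨hv, rfl⟩⟩
  have hreach : ∀ n v, d v = n → ∃ q : S.Walk r v, q.length = n := by
    intro n
    induction n with
    | zero =>
      intro v hv
      have : v = r := by
        by_contra hne
        have := (hpar v hne).2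
        omega
      subst this
      exact ⟨.nil, rfl⟩
    | succ n ih =>
      intro v hv
      have hne : v ≠ r := by
        rintro rfl
        omega
      obtain ⟨q, hq⟩ := ih (par v) (by have := (hpar v hne).2; omega)
      exact ⟨q.concat (hadj v hne), by simp [hq]⟩
  have hconn : S.Connected := by
    have : Nonempty V := ⟨r⟩
    refine ⟨fun v w => ?_⟩
    obtain ⟨p, -⟩ := hreach _ v rfl
    obtain ⟨q, -⟩ := hreach _ w rfl
    exact p.reachable.symm.trans q.reachable
  have hwalk : ∀ {v w : V} (q : S.Walk v w), d w ≤ d v + q.length := by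
    intro v w q
    induction q with
    | nil => simp
    | @cons u v w h q ih =>
      rw [SimpleGraph.Walk.length_cons]
      rcases h.2 with ⟨h1, h2⟩ | ⟨h1, h2⟩
      · have := (hpar _ h1).2
        rw [← h2] at this
        omega
      · have := (hpar _ h1).2
        rw [← h2] at this
        omega
  have hdist : ∀ v, S.dist r v = d v := by
    intro v
    obtain ⟨q, hq⟩ := hreach _ v rfl
    obtain ⟨q', hq'⟩ := hconn.exists_walk_length_eq_dist r v
    have h1 := SimpleGraph.dist_le q
    have h2 := hwalk q'
    omega
  refine ⟨S, ?_, ?_, fun v w h hvw => ?_⟩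
  · rintro v w ⟨-, ⟨h1, rfl⟩ | ⟨h1, rfl⟩⟩
    exacts [(hpar _ h1).1, (hpar _ h1).1.symm]
  · refine SimpleGraph.isTree_iff_connected_and_card.2 ⟨hconn, ?_⟩
    refine le_antisymm ?_ hconn.card_vert_le_card_edgeSet_add_one
    have hsub : S.edgeSet ⊆ ↑((Finset.univ.erase r).image fun v => s(par v, v)) := by
      intro e
      induction e with
      | _ v w =>
        intro h
        obtain ⟨-, ⟨h1, rfl⟩ | ⟨h1, rfl⟩⟩ : S.Adj v w := h
        · exact Finset.mem_coe.2 (Finset.mem_image.2 ⟨w, by simp [h1], rfl⟩)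
        · exact Finset.mem_coe.2 (Finset.mem_image.2 ⟨v, by simp [h1], Sym2.eq_swap⟩)
    have h1 := Set.ncard_le_ncard hsub (Finset.finite_toSet _)
    rw [Set.ncard_coe_finset] at h1
    have h2 := h1.trans Finset.card_image_le
    rw [Finset.card_erase_of_mem (Finset.mem_univ r), Finset.card_univ] at h2
    have h3 : 0 < Fintype.card V := Fintype.card_pos_iff.2 ⟨r⟩
    rw [Nat.card_coe_set_eq, Nat.card_eq_fintype_card]
    omega
  · rw [hdist, hdist] at hvw
    rcases h.2 with h | ⟨h1, h2⟩
    · exact h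
    · have := (hpar v h1).2
      rw [← h2] at this
      omega

/-- A feasible system of difference constraints along the edges of a connected graph has a solution
for which the constraints pointing away from the root in some spanning tree are tight. -/
theorem exists_tight_isTree [Finite V] {H : SimpleGraph V} (hH : H.Connected) (r : V)
    (c : V → V → ℝ) (hfeas : ∃ π : V → ℝ, ∀ v w, H.Adj v w → π v + c v w ≤ π w) :
    ∃ π : V → ℝ, (∀ v w, H.Adj v w → π v + c v w ≤ π w) ∧ ∃ S ≤ H, S.IsTree ∧
      ∀ v w, S.Adj v w → S.dist r w = S.dist r v + 1 → π w = π v + c v w := by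
  obtain ⟨π, par, d, hπ, hd, hpar⟩ := exists_tight_parent hH r c hfeas
  obtain ⟨S, hle, hS, hdist⟩ :=
    exists_isTree_of_parent r par d hd fun v hv => ⟨(hpar v hv).1, (hpar v hv).2.2⟩
  refine ⟨π, hπ, S, hle, hS, fun v w h hvw => ?_⟩
  obtain ⟨hw, rfl⟩ := hdist v w h hvw
  exact (hpar w hw).2.1

/-! ### Counting polytropes -/

namespace Instance

/-- The real part of the lower bound on `π w - π v` for an edge `{v, w}`: it is `l a` if
`a = (v, w)` is an arc and `-u a` if `a = (w, v)` is an arc. -/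
def stepBound (I : Instance V) (v w : V) : ℝ :=
  if h : I.G.Adj v w then I.l (arcOfAdj h) else
    if h : I.G.Adj w v then -I.u (arcOfAdj h) else 0

/-- The periodic offset collected in a step from `v` to `w`: it is `p a` if `a = (v, w)` is an arc
and `-p a` if `a = (w, v)` is an arc. -/
def stepOffset (I : Instance V) (p : Arc I.G → ℤ) (v w : V) : ℤ :=
  if h : I.G.Adj v w then p (arcOfAdj h) else if h : I.G.Adj w v then -p (arcOfAdj h) else 0

theorem mem_polyhedron_iff_forall_adj {I : Instance V} (hI : I.IsStandard) {p : Arc I.G → ℤ}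
    {π : V → ℝ} :
    π ∈ I.polyhedron p ↔ ∀ v w, (underlyingGraph I.G).Adj v w →
      π v + (I.stepBound v w - I.T * I.stepOffset p v w) ≤ π w := by
  constructor
  · rintro h v w ⟨-, hvw | hwv⟩
    · have := (h (arcOfAdj hvw)).1
      simp only [stepBound, stepOffset, hvw, dif_pos]
      change _ ≤ π w - π v at this
      linarith
    · have := (h (arcOfAdj hwv)).2
      simp only [stepBound, stepOffset, hwv, hI.no_antiparallel _ _ hwv, dif_pos, dif_neg,
        not_false_eq_true]
      change π v - π w ≤ _ at this
      push_cast
      linarith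
  · intro h a
    have ha : I.G.Adj a.tail a.head := a.2
    have ha' := hI.no_antiparallel _ _ ha
    have hne : a.tail ≠ a.head := fun e => hI.loopless _ (e ▸ ha)
    have h1 := h _ _ ⟨hne, Or.inl ha⟩
    have h2 := h _ _ ⟨hne.symm, Or.inr ha⟩
    simp only [stepBound, stepOffset, ha, ha', dif_pos, dif_neg, not_false_eq_true] at h1 h2
    change _ + (I.l a - I.T * p a) ≤ _ at h1
    change _ + (-I.u a - I.T * ((-p a : ℤ) : ℝ)) ≤ _ at h2
    push_cast at h2
    constructor <;> linarith

/-- Two points whose step bounds away from the root are tight on the same spanning tree agree in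
the torus: along each tree edge their differences agree modulo `T`. -/
theorem toTorus_eq_of_tight {I : Instance V} {S : SimpleGraph V} (hS : S.Connected) (r : V)
    {p p' : Arc I.G → ℤ} {π π' : V → ℝ}
    (h : ∀ v w, S.Adj v w → S.dist r w = S.dist r v + 1 →
      π w = π v + (I.stepBound v w - I.T * I.stepOffset p v w))
    (h' : ∀ v w, S.Adj v w → S.dist r w = S.dist r v + 1 →
      π' w = π' v + (I.stepBound v w - I.T * I.stepOffset p' v w)) :
    toTorus V I.T π = toTorus V I.T π' := by
  have key : ∀ n v, S.dist r v = n → ∃ k : ℤ, π' v = π v + I.T * k + (π' r - π r) := by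
    intro n
    induction n with
    | zero =>
      intro v hv
      obtain rfl := hS.dist_eq_zero_iff.1 hv
      exact ⟨0, by simp⟩
    | succ n ih =>
      intro w hw
      obtain ⟨q, hq⟩ := hS.exists_walk_length_eq_dist w r
      rw [SimpleGraph.dist_comm, hw] at hq
      obtain ⟨v, hadj, q', rfl⟩ := SimpleGraph.Walk.exists_eq_cons_of_ne
        (show w ≠ r by rintro rfl; simp at hw) q
      have hv : S.dist r v = n := by
        have h1 := SimpleGraph.dist_le q'
        have h2 := hS.dist_triangle (u := r) (v := v) (w := w)
        have h3 := SimpleGraph.dist_eq_one_iff_adj.2 hadj.symm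
        rw [SimpleGraph.dist_comm] at h1
        rw [SimpleGraph.Walk.length_cons] at hq
        omega
      obtain ⟨k, hk⟩ := ih v hv
      refine ⟨k + I.stepOffset p v w - I.stepOffset p' v w, ?_⟩
      rw [h v w hadj.symm (by omega), h' v w hadj.symm (by omega), hk]
      push_cast
      ring
  choose k hk using fun v => key _ v rfl
  exact toTorus_eq_iff.2 ⟨k, _, hk⟩

/-- Every non-empty polytrope contains the torus point of a spanning tree of tight constraints, and
the tree determines this point, hence the polytrope. -/
theorem exists_injOn_spanningTrees [Finite V] {I : Instance V} (hI : I.IsStandard) :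
    ∃ f : Set (Torus V I.T) → SimpleGraph V,
      Set.MapsTo f I.polytropes (spanningTrees I.G) ∧ Set.InjOn f I.polytropes := by
  obtain ⟨r⟩ := hI.connected.nonempty
  have key : ∀ P ∈ I.polytropes, ∃ S ∈ spanningTrees I.G, ∃ (p : Arc I.G → ℤ) (π : V → ℝ),
      P = I.torusPolytrope p ∧ π ∈ I.polyhedron p ∧
      ∀ v w, S.Adj v w → S.dist r w = S.dist r v + 1 →
        π w = π v + (I.stepBound v w - I.T * I.stepOffset p v w) := by
    rintro _ ⟨hne, p, rfl⟩
    obtain ⟨π₀, hπ₀⟩ := hne.of_image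
    obtain ⟨π, hπ, S, hle, hS, ht⟩ := exists_tight_isTree hI.connected r _
      ⟨π₀, (mem_polyhedron_iff_forall_adj hI).1 hπ₀⟩
    exact ⟨S, ⟨hle, hS⟩, p, π, rfl, (mem_polyhedron_iff_forall_adj hI).2 hπ, ht⟩
  choose! f hf p π hp hπ ht using key
  refine ⟨f, hf, fun P hP P' hP' h => ?_⟩
  rw [hp P hP, hp P' hP']
  exact torusPolytrope_eq_of_toTorus_eq hI (hπ P hP) (hπ P' hP')
    (toTorus_eq_of_tight (hf P hP).2.connected r (ht P hP) (h ▸ ht P' hP'))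

end Instance

end PESP

end

theorem mainTheorem3 {V : Type*} [Finite V] (I : PESP.Instance V) (hI : I.IsStandard)
    (B : PESP.IntegralCycleBasis I.G) :
    -- the region of a cycle offset is well defined for every integer vector
    (∀ z, (∃ p, B.matrix.mulVec p = z) ∧
      ∀ p, B.matrix.mulVec p = z → I.offsetPolytrope B z = I.torusPolytrope p) ∧
    -- integer points of the zonotope correspond to the non-empty polytropes
    Set.BijOn (I.offsetPolytrope B) (I.integerPoints B) I.polytropes ∧
    -- the non-empty polytropes decompose the timetable space on the torus
    ⋃₀ I.polytropes = PESP.toTorus V I.T '' I.timetableSpace ∧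
    I.polytropes.PairwiseDisjoint id ∧
    -- the number of polytropes is bounded by the number of spanning trees
    I.polytropes.Finite ∧ I.polytropes.ncard ≤ (PESP.spanningTrees I.G).ncard := by
  obtain ⟨f, hf, hinj⟩ := PESP.Instance.exists_injOn_spanningTrees hI
  have hfin : (PESP.spanningTrees I.G).Finite := Set.toFinite _
  exact ⟨fun z => ⟨PESP.exists_matrix_mulVec_eq hI.no_antiparallel hI.connected B z,
      fun p hp => PESP.Instance.offsetPolytrope_eq hI B hp⟩,
    PESP.Instance.bijOn_offsetPolytrope hI B, PESP.Instance.sUnion_polytropes I,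
    PESP.Instance.pairwiseDisjoint_polytropes hI, Set.Finite.of_injOn hf hinj hfin,
    Set.ncard_le_ncard_of_injOn f hf hinj hfin⟩
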